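/- Let $\mathcal C$ be a Grothendieck category (an abelian category with exact filtered colimits and a generator) that has a projective generator $G$. A monad $(U,\theta,\eta)$ on $\mathcal C$ has an Eilenberg--Moore category $EM_U$ of $U$-modules $(M,f_M\colon UM\to M)$. A morphism of monads $\phi\colon U\to U'$ is a natural transformation compatible with multiplications and units; it induces the restriction functor $\phi_*\colon EM_{U'}\to EM_U$, $(M',f_{M'})\mapsto (M',f_{M'}\circ\phi_{M'})$. If $U'$ preserves colimits, $\phi_*$ has the left adjoint $$\phi^*(M)=\mathrm{Coeq}\Bigl(U'UM\rightrightarrows U'M\Bigr)$$ in $EM_{U'}$, the two arrows being $\theta'_M\circ U'(\phi_M)$ and $U'(f_M)$. Call $\phi$ flat if $\phi^*$ is exact. Let $\mathbb Q$ be a (small) partially ordered set, viewed as a category, and let $\mathscr U\colon\mathbb Q\to \mathrm{Mnd}(\mathcal C)$ be a functor to the category of monads on $\mathcal C$ such that every monad $\mathscr U_x$ $(x\in\mathbb Q)$ is exact and preserves colimits. Assume that $\mathscr U$ is flat, i.e. $\mathscr U(\phi)$ is a flat morphism of monads for every arrow $\phi$ of $\mathbb Q$; write $\phi_*,\phi^*$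 for $\mathscr U(\phi)_*,\mathscr U(\phi)^*$. A $\mathscr U$-module $\mathscr M$ consists of objects $\mathscr M_x\in EM_{\mathscr U_x}$ $(x\in\mathbb Q)$ and morphisms $\mathscr M_\phi\colon\mathscr M_x\to\phi_*\mathscr M_y$ in $EM_{\mathscr U_x}$ for the arrows $\phi\colon x\to y$ of $\mathbb Q$, with $\mathscr M_{\mathrm{id}_x}=\mathrm{id}_{\mathscr M_x}$ and $\mathscr M_{\psi\phi}=\phi_*(\mathscr M_\psi)\circ\mathscr M_\phi$ for composable arrows. A morphism $\xi\colon\mathscr M\to\mathscr M'$ consists of morphisms $\xi_x\colon\mathscr M_x\to\mathscr M'_x$ in $EM_{\mathscr U_x}$ with $\mathscr M'_\phi\circ\xi_x=\phi_*(\xi_y)\circ\mathscr M_\phi$ for every arrow $\phi\colon x\to y$. The module $\mathscr M$ is cartesian if for every arrow $\phi\colon x\to y$ the morphism $\mathscr M^\phi\colon\phi^*\mathscr M_x\to\mathscr M_y$ adjoint to $\mathscr M_\phi$ is an isomorphism. Then the full subcategory $\mathrm{Cart}\text{-}\mathscr U$ of cartesian modules in the category of $\mathscr U$-modules is a Grothendieck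 category. -/

import Mathlib

open CategoryTheory CategoryTheory.Limits

universe v u

noncomputable section

namespace MonadQuiver

section Scalars

variable {C : Type u} [Category.{v} C]

/-- A colimit-preserving monad on a category with coequalizers has an Eilenberg-Moore category
with coequalizers; they are computed in the base category. -/
instance hasCoequalizers_algebra (T : Monad C) [HasCoequalizers C]
    [PreservesColimits T.toFunctor] : HasCoequalizers T.Algebra :=
  ⟨fun D => Monad.forget_creates_colimits_of_monad_preserves D⟩

/-- The restriction to `X` of a morphism of algebras out of the free algebra on `X`. -/
def freeRestrict {T : Monad C} {X : C} {N : T.Algebra} (k : T.free.obj X ⟶ N) : X ⟶ N.A :=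
  T.η.app X ≫ (show (T : C ⥤ C).obj X ⟶ N.A from k.f)

/-- The morphism of algebras out of the free algebra on `X` that extends a given morphism. -/
def freeLift {T : Monad C} {X : C} {N : T.Algebra} (g : X ⟶ N.A) : T.free.obj X ⟶ N where
  f := (T : C ⥤ C).map g ≫ N.a
  h := by
    have h1 := T.μ.naturality_assoc g N.a
    have h2 := N.assoc
    simp only [Functor.comp_map] at h1
    simp only [Monad.free, Functor.map_comp, Category.assoc]
    rw [← h2]
    exact h1

theorem freeRestrict_freeLift {T : Monad C} {X : C} {N : T.Algebra} (g : X ⟶ N.A) :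
    freeRestrict (freeLift g) = g := by
  have h1 := T.η.naturality_assoc g N.a
  have h2 := N.unit
  simp only [Functor.id_map] at h1
  exact h1.symm.trans ((congrArg (fun q => g ≫ q) h2).trans (Category.comp_id g))

theorem freeLift_freeRestrict {T : Monad C} {X : C} {N : T.Algebra} (k : T.free.obj X ⟶ N) :
    freeLift (freeRestrict k) = k := by
  ext
  have h1 (l : (T : C ⥤ C).obj X ⟶ N.A) (hl : (T : C ⥤ C).map l ≫ N.a = T.μ.app X ≫ l) :
      (T : C ⥤ C).map (T.η.app X ≫ l) ≫ N.a = l := by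
    rw [Functor.map_comp, Category.assoc, hl]
    exact T.right_unit_assoc X l
  exact h1 k.f k.h

theorem freeRestrict_injective {T : Monad C} {X : C} {N : T.Algebra} :
    Function.Injective (freeRestrict : (T.free.obj X ⟶ N) → (X ⟶ N.A)) :=
  Function.LeftInverse.injective freeLift_freeRestrict

theorem freeRestrict_comp {T : Monad C} {X : C} {N N' : T.Algebra} (k : T.free.obj X ⟶ N)
    (g : N ⟶ N') : freeRestrict (k ≫ g) = freeRestrict k ≫ g.f :=
  (Category.assoc _ _ _).symm

variable {T T' : Monad C} (φ : T ⟶ T')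

/-- Restriction of scalars `φ_* : EM_{T'} ⥤ EM_T`, `(M', f) ↦ (M', φ_{M'} ≫ f)`. -/
abbrev restrict : T'.Algebra ⥤ T.Algebra :=
  Monad.algebraFunctorOfMonadHom φ

/-- The morphism of free `T'`-algebras `T'TM ⟶ T'M` given by `T'(f_M)`. -/
def extendLeft (M : T.Algebra) : T'.free.obj ((T : C ⥤ C).obj M.A) ⟶ T'.free.obj M.A :=
  T'.free.map M.a

/-- The morphism of free `T'`-algebras `T'TM ⟶ T'M` given by `θ'_M ∘ T'(φ_M)`. -/
def extendRight (M : T.Algebra) : T'.free.obj ((T : C ⥤ C).obj M.A) ⟶ T'.free.obj M.A where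
  f := (T' : C ⥤ C).map (φ.app M.A) ≫ T'.μ.app M.A
  h := by
    have h1 := T'.μ.naturality (φ.app M.A)
    have h2 := T'.assoc M.A
    simp only [Functor.comp_map] at h1
    simp [Monad.free, reassoc_of% h1, h2]

/-- A morphism of `T'`-algebras out of the free algebra on `M` coequalizes `T'TM ⇉ T'M`
exactly when its restriction to `M` is a morphism of `T`-algebras. -/
theorem coequalizes_iff (M : T.Algebra) (N : T'.Algebra) (k : T'.free.obj M.A ⟶ N) :
    extendLeft (T' := T') M ≫ k = extendRight φ M ≫ k ↔
      (T : C ⥤ C).map (freeRestrict k) ≫ φ.app N.A ≫ N.a = M.a ≫ freeRestrict k := by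
  have hk : (T' : C ⥤ C).map (freeRestrict k) ≫ N.a = k.f :=
    congrArg Monad.Algebra.Hom.f (freeLift_freeRestrict k)
  have hR : (T : C ⥤ C).map (freeRestrict k) ≫ φ.app N.A ≫ N.a = φ.app M.A ≫ k.f := by
    rw [← hk]
    exact φ.naturality_assoc (freeRestrict k) N.a
  have hl : freeRestrict (extendLeft (T' := T') M ≫ k) = M.a ≫ freeRestrict k :=
    (T'.η.naturality_assoc M.a k.f).symm
  have hr : freeRestrict (extendRight φ M ≫ k) = φ.app M.A ≫ k.f := by
    have h6 := T'.η.naturality_assoc (φ.app M.A) (T'.μ.app M.A ≫ k.f)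
    have h7 := T'.left_unit_assoc M.A k.f
    refine Eq.trans ?_ (h6.symm.trans (congrArg (fun q => φ.app M.A ≫ q) h7))
    exact congrArg (fun q => T'.η.app _ ≫ q) (Category.assoc _ _ _)
  rw [hR, ← hl, ← hr, freeRestrict_injective.eq_iff, eq_comm]

variable [HasCoequalizers T'.Algebra]

/-- The object `φ^* M`, the coequalizer of `T'TM ⇉ T'M` in `EM_{T'}`. -/
abbrev extendObj (M : T.Algebra) : T'.Algebra :=
  coequalizer (extendLeft (T' := T') M) (extendRight φ M)

/-- The projection `T'M ⟶ φ^* M`. -/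
abbrev extendProj (M : T.Algebra) : T'.free.obj M.A ⟶ extendObj φ M :=
  coequalizer.π (extendLeft (T' := T') M) (extendRight φ M)

/-- The bijection `EM_{T'}(φ^* M, N) ≃ EM_T(M, φ_* N)`. -/
def extendEquiv (M : T.Algebra) (N : T'.Algebra) :
    (extendObj φ M ⟶ N) ≃ (M ⟶ (restrict φ).obj N) where
  toFun h :=
    { f := freeRestrict (N := N) (extendProj φ M ≫ h)
      h := (coequalizes_iff φ M N (extendProj φ M ≫ h)).1 (by
        rw [← Category.assoc, coequalizer.condition (extendLeft (T' := T') M) (extendRight φ M),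
          Category.assoc]) }
  invFun g := coequalizer.desc (f := extendLeft (T' := T') M) (g := extendRight φ M)
    (freeLift (N := N) g.f) ((coequalizes_iff φ M N _).2 (by
      have e : freeRestrict (freeLift (N := N) g.f) = g.f := freeRestrict_freeLift _
      rw [e]
      exact g.h))
  left_inv h := by
    apply coequalizer.hom_ext
    rw [coequalizer.π_desc]
    exact freeLift_freeRestrict (extendProj φ M ≫ h)
  right_inv g := by
    ext
    change freeRestrict (_ ≫ coequalizer.desc _ _) = _
    rw [coequalizer.π_desc]
    exact freeRestrict_freeLift _

theorem extendEquiv_naturality (M : T.Algebra) (N N' : T'.Algebra) (g : N ⟶ N')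
    (h : extendObj φ M ⟶ N) :
    extendEquiv φ M N' (h ≫ g) = extendEquiv φ M N h ≫ (restrict φ).map g := by
  ext
  exact (congrArg freeRestrict (Category.assoc (extendProj φ M) h g).symm).trans
    (freeRestrict_comp (extendProj φ M ≫ h) g)

/-- Extension of scalars `φ^* : EM_T ⥤ EM_{T'}`. -/
def extend : T.Algebra ⥤ T'.Algebra :=
  Adjunction.leftAdjointOfEquiv (extendEquiv φ) (extendEquiv_naturality φ)

/-- `φ^*` is left adjoint to `φ_*`. -/
def extendAdj : extend φ ⊣ restrict φ :=
  Adjunction.adjunctionOfEquivLeft (extendEquiv φ) (extendEquiv_naturality φ)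

/-- A morphism of monads `φ` is flat if `φ^*` is exact. -/
structure IsFlat : Prop where
  preservesFiniteLimits : PreservesFiniteLimits (extend φ)
  preservesFiniteColimits : PreservesFiniteColimits (extend φ)

end Scalars

variable {C : Type u} [Category.{v} C] {Q : Type v} [PartialOrder Q]

/-- A module over the monad quiver `U : Q ⥤ Mnd(C)`. The two axioms are equations between
morphisms of `C`; restriction of scalars does not change underlying objects. -/
structure Mod (U : Q ⥤ Monad C) where
  obj (x : Q) : (U.obj x).Algebra
  map {x y : Q} (φ : x ⟶ y) : obj x ⟶ (restrict (U.map φ)).obj (obj y)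
  map_id (x : Q) : (map (𝟙 x)).f = 𝟙 (obj x).A
  map_comp {x y z : Q} (φ : x ⟶ y) (ψ : y ⟶ z) :
    (map (φ ≫ ψ)).f = (map φ).f ≫ (map ψ).f

namespace Mod

variable {U : Q ⥤ Monad C}

/-- A morphism of modules over a monad quiver. -/
@[ext]
structure Hom (M N : Mod U) where
  app (x : Q) : M.obj x ⟶ N.obj x
  naturality {x y : Q} (φ : x ⟶ y) :
    M.map φ ≫ (restrict (U.map φ)).map (app y) = app x ≫ N.map φ

instance : Category (Mod U) where
  Hom := Hom
  id M := { app := fun x => 𝟙 (M.obj x), naturality := fun φ => by simp }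
  comp f g :=
    { app := fun x => f.app x ≫ g.app x
      naturality := fun φ => by
        rw [Functor.map_comp, ← Category.assoc, f.naturality, Category.assoc, g.naturality,
          Category.assoc] }
  id_comp f := Hom.ext (funext fun _ => Category.id_comp _)
  comp_id f := Hom.ext (funext fun _ => Category.comp_id _)
  assoc f g h := Hom.ext (funext fun _ => Category.assoc _ _ _)

end Mod

/-- A monad quiver is flat if the morphism of monads at every arrow is flat. -/
def Flat (U : Q ⥤ Monad C) [∀ x, HasCoequalizers (U.obj x).Algebra] : Prop :=
  ∀ ⦃x y : Q⦄ (φ : x ⟶ y), IsFlat (U.map φ)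

/-- A module is cartesian if, for every arrow `φ : x ⟶ y`, the morphism `φ^* M_x ⟶ M_y`
corresponding to `M_x ⟶ φ_* M_y` is an isomorphism. -/
def isCartesian (U : Q ⥤ Monad C) [∀ x, HasCoequalizers (U.obj x).Algebra] :
    ObjectProperty (Mod U) :=
  fun M => ∀ ⦃x y : Q⦄ (φ : x ⟶ y),
    IsIso (((extendAdj (U.map φ)).homEquiv (M.obj x) (M.obj y)).symm (M.map φ))

/-- The full subcategory of cartesian modules over a monad quiver. -/
abbrev Cart (U : Q ⥤ Monad C) [∀ x, HasCoequalizers (U.obj x).Algebra] :=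
  (isCartesian U).FullSubcategory

end MonadQuiver

end

/-! Exactness. Limits and colimits of modules are computed pointwise, and pointwise in `C`.
Cartesian modules are closed under colimits because each `φ^*` is a left adjoint, and under finite
limits because each `φ^*` is exact. Hence taking underlying diagrams is an exact, conservative,
cocontinuous functor from `Cart U` to `Q ⥤ C`, and along such a functor both abelianness and AB5
descend (`abelianOfExactConservative`, `ab5OfSize_of_exact_conservative`).

Generator. Let `G x` be the free algebra on a separator of `C`, and call a morphism `G x ⟶ M.obj x`
an element over `x`. Every element of a cartesian module lies in a cartesian submodule of bounded
size (`exists_isCartesian_submodule`), obtained by closing it under two operations. Going up along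
`x ⟶ y`, add all elements of the image of its extension of scalars. Going down along `z ⟶ x`, the
element comes from `φ^* M_z`, and finitely generated subobjects of `M_z` form a filtered union
preserved by `φ^*`. The object `G x` need not factor through a single stage, but the stages pull
back to subobjects of `G x`, of which there is only a set; one finite set of elements over `z` for
each of them suffices (`exists_factors_map_arrow`).

The closure is indexed by words that do not depend on `M`. The components of the submodules are
therefore quotients of fixed coproducts, so a set of isomorphism classes suffices, and the coproduct
of representatives is a separator (`hasSeparator_cart`). -/

noncomputable section

namespace MonadQuiver

/-! ### Descent of abelianness and AB5 along exact conservative functors -/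

section Transfer

/-- A preadditive category with finite limits and colimits is abelian if it admits an exact
conservative functor to an abelian category. -/
abbrev abelianOfExactConservative {A B : Type*} [Category* A] [Category* B] [Preadditive A]
    [HasFiniteLimits A] [HasFiniteColimits A] [Abelian B] (F : A ⥤ B) [PreservesFiniteLimits F]
    [PreservesFiniteColimits F] [F.ReflectsIsomorphisms] [F.PreservesZeroMorphisms] :
    Abelian A := by
  -- An exact functor carries the coimage-image comparison of `f` to that of `F.map f`, which is
  -- invertible in `B`; conservativity brings this back.
  have : ∀ {X Y : A} (f : X ⟶ Y), IsIso (Abelian.coimageImageComparison f) := by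
    intro X Y f
    have : IsIso (F.map (Abelian.coimageImageComparison f)) :=
      (Arrow.isIso_iff_isIso_of_isIso (Abelian.PreservesCoimageImageComparison.iso F f).hom).2
        (inferInstanceAs (IsIso (Abelian.coimageImageComparison (F.map f))))
    exact isIso_of_reflects_iso _ F
  exact Abelian.ofCoimageImageComparisonIsIso

/-- The axiom `AB5` can be checked after an exact conservative functor that preserves filtered
colimits. -/
theorem ab5OfSize_of_exact_conservative {A B : Type*} [Category* A] [Category* B]
    [HasFiniteLimits A] [HasFilteredColimitsOfSize.{v, v} A] [HasFilteredColimitsOfSize.{v, v} B]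
    [AB5OfSize.{v, v} B] (F : A ⥤ B) [PreservesFiniteLimits F] [F.ReflectsIsomorphisms]
    [PreservesColimitsOfSize.{v, v} F] : AB5OfSize.{v, v} A where
  ofShape J _ _ := by
    have : ReflectsFiniteLimits F :=
      ⟨fun J _ _ => reflectsLimitsOfShape_of_reflectsIsomorphisms⟩
    exact HasExactColimitsOfShape.domain_of_functor J F

end Transfer

/-! ### Eilenberg–Moore categories are Grothendieck -/

section AlgebraCategory

variable {C : Type u} [Category.{v} C] [Abelian C]

/-- Morphisms out of the free algebra on `G` are morphisms out of `G` in the base, where `G` already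
separates. -/
theorem isSeparator_free {C : Type u} [Category.{v} C] (T : Monad C) {G : C}
    (hG : IsSeparator G) : IsSeparator (T.free.obj G) := by
  rw [isSeparator_def] at hG ⊢
  intro X Y f g h
  apply Monad.Algebra.Hom.ext
  apply hG
  intro k
  have := congrArg freeRestrict (h (freeLift k))
  rwa [freeRestrict_comp, freeRestrict_comp, freeRestrict_freeLift] at this

variable (T : Monad C) [PreservesFiniteLimits T.toFunctor]

instance additive_of_preservesFiniteLimits : T.toFunctor.Additive :=
  Functor.additive_of_preserves_binary_products _

variable [IsGrothendieckAbelian.{v} C] [PreservesColimits T.toFunctor]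

instance : HasFiniteLimits T.Algebra :=
  ⟨fun _ _ _ => hasLimitsOfShape_of_hasLimitsOfShape_createsLimitsOfShape T.forget⟩

instance : HasColimits T.Algebra :=
  ⟨fun _ _ => hasColimitsOfShape_of_hasColimitsOfShape_createsColimitsOfShape T.forget⟩

instance preservesColimits_forget : PreservesColimits T.forget :=
  ⟨⟨inferInstance⟩⟩

instance algebraAbelian : Abelian T.Algebra :=
  have : HasFiniteColimits T.Algebra := hasFiniteColimits_of_hasColimits _
  have : PreservesFiniteColimits T.forget := PreservesColimits.preservesFiniteColimits _
  have : PreservesFiniteLimits T.forget := inferInstance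
  abelianOfExactConservative T.forget

instance algebra_isGrothendieckAbelian : IsGrothendieckAbelian.{v} T.Algebra where
  hasFilteredColimitsOfSize := ⟨fun _ _ _ => inferInstance⟩
  ab5OfSize := by
    have : HasFilteredColimitsOfSize.{v, v} T.Algebra := ⟨fun _ _ _ => inferInstance⟩
    exact ab5OfSize_of_exact_conservative T.forget
  hasSeparator := ⟨⟨_, isSeparator_free T (isSeparator_separator C)⟩⟩

end AlgebraCategory

end MonadQuiver
end

/-! ### Modules over a monad quiver, with pointwise limits and colimits -/

noncomputable section

namespace MonadQuiver

section Squares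

variable {A : Type*} [Category* A] {W X X' X'' Y Y' Y'' Z : A}

/-- This and the next three are pastings over arbitrary objects, applied up to definitional
unfolding of evaluation and restriction of scalars. -/
theorem square_comp {a : X ⟶ X'} {c : X' ⟶ X''} {b : Y ⟶ Y'} {d : Y' ⟶ Y''} {p : X ⟶ Y}
    {p' : X' ⟶ Y'} {p'' : X'' ⟶ Y''} (h : a ≫ p' = p ≫ b) (h' : c ≫ p'' = p' ≫ d) :
    (a ≫ c) ≫ p'' = p ≫ b ≫ d := by
  rw [Category.assoc, h', ← Category.assoc, h, Category.assoc]

theorem square_triangle {p : W ⟶ X} {q : X ⟶ Y} {s : W ⟶ X'} {t : X' ⟶ Y} {r : Y ⟶ Z} {r' : X ⟶ Z}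
    (h : p ≫ q = s ≫ t) (h' : q ≫ r = r') : s ≫ t ≫ r = (p ≫ r') ≫ 𝟙 _ := by
  rw [← h', Category.comp_id, ← Category.assoc, ← h, Category.assoc]

theorem triangle_square {p : W ⟶ X} {p' : W ⟶ X'} {q : X ⟶ X'} {s : X ⟶ Y} {t : Y ⟶ Z} {r : X' ⟶ Z}
    (h : s ≫ t = q ≫ r) (h' : p ≫ q = p') : 𝟙 _ ≫ p' ≫ r = (p ≫ s) ≫ t := by
  rw [← h', Category.id_comp, Category.assoc, Category.assoc, h]

theorem comp_eq_of_squares {a : W ⟶ X} {b : X ⟶ Y} {c : W ⟶ X'} {d : X' ⟶ Y} {e : Y ⟶ Z}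
    {f : X' ⟶ Z} {g : W ⟶ Y'} {k : Y' ⟶ Z} {l : X ⟶ Y'} (h₁ : a ≫ b = c ≫ d) (h₂ : d ≫ e = f)
    (h₃ : c ≫ f = g ≫ k) (h₄ : a ≫ l = g) : a ≫ b ≫ e = a ≫ l ≫ k := by
  rw [← Category.assoc, h₁, Category.assoc, h₂, h₃, ← h₄, Category.assoc]

end Squares

section NatTransIso

variable {A B J : Type*} [Category* A] [Category* B] [Category* J] {F F' : A ⥤ B} (α : F ⟶ F')
  {K : J ⥤ A} [∀ j, IsIso (α.app (K.obj j))]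

/-- With `α` the comparison `φ^* M_x ⟶ M_y`, this and its dual say that being cartesian passes to
colimits and limits preserved by both functors. -/
theorem isIso_app_pt_of_isColimit {c : Cocone K} (hF : IsColimit (F.mapCocone c))
    (hF' : IsColimit (F'.mapCocone c)) : IsIso (α.app c.pt) := by
  have : ∀ j, IsIso ((Functor.whiskerLeft K α).app j) := fun j =>
    inferInstanceAs (IsIso (α.app (K.obj j)))
  have : IsIso (Functor.whiskerLeft K α) := NatIso.isIso_of_isIso_app _
  have h : α.app c.pt =
      (hF.coconePointsIsoOfNatIso hF' (asIso (Functor.whiskerLeft K α))).hom :=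
    hF.hom_ext fun j => by
      rw [IsColimit.comp_coconePointsIsoOfNatIso_hom]
      exact α.naturality (c.ι.app j)
  rw [h]
  infer_instance

theorem isIso_app_pt_of_isLimit {c : Cone K} (hF : IsLimit (F.mapCone c))
    (hF' : IsLimit (F'.mapCone c)) : IsIso (α.app c.pt) := by
  have : ∀ j, IsIso ((Functor.whiskerLeft K α).app j) := fun j =>
    inferInstanceAs (IsIso (α.app (K.obj j)))
  have : IsIso (Functor.whiskerLeft K α) := NatIso.isIso_of_isIso_app _
  have h : α.app c.pt =
      (hF.conePointsIsoOfNatIso hF' (asIso (Functor.whiskerLeft K α))).hom :=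
    hF'.hom_ext fun j => by
      rw [IsLimit.conePointsIsoOfNatIso_hom_comp]
      exact (α.naturality (c.π.app j)).symm
  rw [h]
  infer_instance

end NatTransIso

variable {C : Type u} [Category.{v} C] {Q : Type v} [PartialOrder Q]

namespace Mod

variable {U : Q ⥤ Monad C}

@[ext]
theorem hom_ext {M N : Mod U} {f g : M ⟶ N} (h : ∀ x, f.app x = g.app x) : f = g :=
  Hom.ext (funext h)

variable (U) in
/-- Evaluation of modules at an element of `Q`. -/
@[simps]
def ev (x : Q) : Mod U ⥤ (U.obj x).Algebra where
  obj M := M.obj x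
  map f := f.app x

variable (U) in
/-- The underlying functor `Q ⥤ C` of a module. -/
@[simps]
def forget : Mod U ⥤ Q ⥤ C where
  obj M :=
    { obj x := (M.obj x).A
      map φ := (M.map φ).f
      map_id := M.map_id
      map_comp := M.map_comp }
  map f :=
    { app x := (f.app x).f
      naturality _ _ φ := congrArg Monad.Algebra.Hom.f (f.naturality φ) }

/-- A family of isomorphisms compatible with the structure morphisms is an isomorphism. -/
@[simps]
def isoMk {M N : Mod U} (e : ∀ x, M.obj x ≅ N.obj x)
    (he : ∀ ⦃x y : Q⦄ (φ : x ⟶ y),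
      M.map φ ≫ (restrict (U.map φ)).map (e y).hom = (e x).hom ≫ N.map φ) : M ≅ N where
  hom := { app x := (e x).hom, naturality φ := he φ }
  inv :=
    { app x := (e x).inv
      naturality φ := by
        rw [← Functor.mapIso_inv, Iso.comp_inv_eq, Category.assoc, Functor.mapIso_hom, he,
          Iso.inv_hom_id_assoc] }
  hom_inv_id := hom_ext fun x => (e x).hom_inv_id
  inv_hom_id := hom_ext fun x => (e x).inv_hom_id

instance : (forget U).ReflectsIsomorphisms where
  reflects {M N} f _ := by
    have (x : Q) : IsIso (f.app x) := by
      have : IsIso ((U.obj x).forget.map (f.app x)) :=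
        inferInstanceAs (IsIso (((forget U).map f).app x))
      exact isIso_of_reflects_iso _ (U.obj x).forget
    exact (isoMk (fun x => asIso (f.app x)) fun _ _ φ => f.naturality φ).isIso_hom

section Preadditive

variable [Preadditive C] [∀ x, (U.obj x).toFunctor.Additive]

instance restrict_additive {T T' : Monad C} [T.toFunctor.Additive] [T'.toFunctor.Additive]
    (φ : T ⟶ T') : (restrict φ).Additive where

/-- Morphisms of modules as a subgroup of families of morphisms of algebras. -/
def homSubgroup (M N : Mod U) : AddSubgroup (∀ x, M.obj x ⟶ N.obj x) where
  carrier := {f | ∀ ⦃x y : Q⦄ (φ : x ⟶ y),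
    M.map φ ≫ (restrict (U.map φ)).map (f y) = f x ≫ N.map φ}
  add_mem' hf hg x y φ := by
    rw [Pi.add_apply, Pi.add_apply, Functor.map_add, Preadditive.comp_add, Preadditive.add_comp,
      hf φ, hg φ]
  zero_mem' x y φ := by
    rw [Pi.zero_apply, Pi.zero_apply, Functor.map_zero, comp_zero, zero_comp]
  neg_mem' hf x y φ := by
    rw [Pi.neg_apply, Pi.neg_apply, Functor.map_neg, Preadditive.comp_neg, Preadditive.neg_comp,
      hf φ]

/-- Morphisms of modules are the elements of `homSubgroup`. -/
def homEquiv (M N : Mod U) : (M ⟶ N) ≃ homSubgroup M N where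
  toFun f := ⟨f.app, fun _ _ φ => f.naturality φ⟩
  invFun f := { app := f.1, naturality φ := f.2 φ }

instance : Preadditive (Mod U) where
  homGroup M N := (homEquiv M N).addCommGroup
  add_comp _ _ _ _ _ _ := hom_ext fun _ => Preadditive.add_comp _ _ _ _ _ _
  comp_add _ _ _ _ _ _ := hom_ext fun _ => Preadditive.comp_add _ _ _ _ _ _

instance : (forget U).Additive where

end Preadditive

section Colimits

variable {J : Type*} [Category* J] (K : J ⥤ Mod U) (c : ∀ x, Cocone (K ⋙ ev U x))

/-- The cocone that induces a structure morphism on pointwise colimits. -/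
@[simps]
def structureCocone {x y : Q} (φ : x ⟶ y) : Cocone (K ⋙ ev U x) where
  pt := (restrict (U.map φ)).obj (c y).pt
  ι :=
    { app j := (K.obj j).map φ ≫ (restrict (U.map φ)).map ((c y).ι.app j)
      naturality i j f := by
        have h := (K.map f).naturality φ
        have h' := congrArg (restrict (U.map φ)).map ((c y).w f)
        rw [Functor.map_comp] at h'
        exact square_triangle h h' }

variable (hc : ∀ x, IsColimit (c x))

theorem desc_structureCocone_f {x y : Q} (φ : x ⟶ y) (j : J) :
    ((c x).ι.app j).f ≫ ((hc x).desc (structureCocone K c φ)).f =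
      ((K.obj j).map φ).f ≫ ((c y).ι.app j).f :=
  congrArg Monad.Algebra.Hom.f ((hc x).fac (structureCocone K c φ) j)

variable [∀ x, PreservesColimitsOfShape J (U.obj x).forget]

/-- The pointwise colimit of modules. -/
@[simps]
def colimitObj : Mod U where
  obj x := (c x).pt
  map φ := (hc _).desc (structureCocone K c φ)
  -- The module axioms are equations in `C`, so the legs must be jointly epic there; this is where
  -- preservation by the forgetful functor enters.
  map_id x := (isColimitOfPreserves (U.obj x).forget (hc x)).hom_ext fun j => by
    refine (desc_structureCocone_f K c hc (𝟙 x) j).trans ?_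
    refine (congrArg (· ≫ ((c x).ι.app j).f) ((K.obj j).map_id x)).trans ?_
    exact (Category.id_comp _).trans (Category.comp_id _).symm
  map_comp {x y z} φ ψ := (isColimitOfPreserves (U.obj x).forget (hc x)).hom_ext fun j => by
    refine (desc_structureCocone_f K c hc (φ ≫ ψ) j).trans ?_
    refine (congrArg (· ≫ ((c z).ι.app j).f) ((K.obj j).map_comp φ ψ)).trans ?_
    exact square_comp (desc_structureCocone_f K c hc φ j).symm
      (desc_structureCocone_f K c hc ψ j).symm

/-- The pointwise colimit cocone. -/
@[simps]
def colimitCocone : Cocone K where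
  pt := colimitObj K c hc
  ι :=
    { app j :=
        { app x := (c x).ι.app j
          naturality φ := ((hc _).fac (structureCocone K c φ) j).symm }
      naturality _ _ f := hom_ext fun x => (c x).ι.naturality f }

/-- The pointwise colimit is a colimit. -/
def isColimitColimitCocone : IsColimit (colimitCocone K c hc) where
  desc s :=
    { app x := (hc x).desc ((ev U x).mapCocone s)
      naturality {x y} φ := (hc x).hom_ext fun j => by
        have h := congrArg (restrict (U.map φ)).map ((hc y).fac ((ev U y).mapCocone s) j)
        rw [Functor.map_comp] at h
        exact comp_eq_of_squares ((hc x).fac (structureCocone K c φ) j) h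
          ((s.ι.app j).naturality φ) ((hc x).fac ((ev U x).mapCocone s) j) }
  fac s j := hom_ext fun x => (hc x).fac ((ev U x).mapCocone s) j
  uniq s m h := hom_ext fun x => (hc x).uniq ((ev U x).mapCocone s) (m.app x) fun j =>
    congrArg (fun q => Hom.app q x) (h j)

theorem hasColimitsOfShape [∀ x, HasColimitsOfShape J (U.obj x).Algebra] :
    HasColimitsOfShape J (Mod U) :=
  ⟨fun K => ⟨⟨_, isColimitColimitCocone K (fun x => colimit.cocone (K ⋙ ev U x))
    fun _ => colimit.isColimit _⟩⟩⟩

theorem preservesColimitsOfShape_ev [∀ x, HasColimitsOfShape J (U.obj x).Algebra] (x : Q) :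
    PreservesColimitsOfShape J (ev U x) :=
  ⟨fun {K} => preservesColimit_of_preserves_colimit_cocone
    (isColimitColimitCocone K (fun x => colimit.cocone (K ⋙ ev U x)) fun _ => colimit.isColimit _)
    (colimit.isColimit (K ⋙ ev U x))⟩

end Colimits

section Limits

variable [∀ x, HasCoequalizers (U.obj x).Algebra]

/-- Restriction thus preserves limits, so a structure morphism into a restricted pointwise limit can
be defined by its components. -/
instance {x y : Q} (φ : x ⟶ y) : (restrict (U.map φ)).IsRightAdjoint :=
  (extendAdj (U.map φ)).isRightAdjoint

variable {J : Type*} [Category* J] (K : J ⥤ Mod U) (c : ∀ x, Cone (K ⋙ ev U x))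

/-- The cone that induces a structure morphism on pointwise limits. -/
@[simps]
def structureCone {x y : Q} (φ : x ⟶ y) : Cone ((K ⋙ ev U y) ⋙ restrict (U.map φ)) where
  pt := (c x).pt
  π :=
    { app j := (c x).π.app j ≫ (K.obj j).map φ
      naturality i j f := by
        have h := (K.map f).naturality φ
        have h' := (c x).w f
        exact triangle_square h h' }

variable (hc : ∀ x, IsLimit (c x))

/-- The structure morphism on pointwise limits. -/
def limitMap {x y : Q} (φ : x ⟶ y) : (c x).pt ⟶ (restrict (U.map φ)).obj (c y).pt :=
  (isLimitOfPreserves (restrict (U.map φ)) (hc y)).lift (structureCone K c φ)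

theorem limitMap_comp {x y : Q} (φ : x ⟶ y) (j : J) :
    limitMap K c hc φ ≫ (restrict (U.map φ)).map ((c y).π.app j) =
      (c x).π.app j ≫ (K.obj j).map φ :=
  (isLimitOfPreserves (restrict (U.map φ)) (hc y)).fac (structureCone K c φ) j

theorem limitMap_comp_f {x y : Q} (φ : x ⟶ y) (j : J) :
    (limitMap K c hc φ).f ≫ ((c y).π.app j).f = ((c x).π.app j).f ≫ ((K.obj j).map φ).f :=
  congrArg Monad.Algebra.Hom.f (limitMap_comp K c hc φ j)

/-- The pointwise limit of modules. -/
@[simps]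
def limitObj : Mod U where
  obj x := (c x).pt
  map φ := limitMap K c hc φ
  map_id x := (isLimitOfPreserves (U.obj x).forget (hc x)).hom_ext fun j => by
    refine (limitMap_comp_f K c hc (𝟙 x) j).trans ?_
    rw [Mod.map_id]
    exact (Category.comp_id _).trans (Category.id_comp _).symm
  map_comp {x y z} φ ψ := (isLimitOfPreserves (U.obj z).forget (hc z)).hom_ext fun j => by
    refine (limitMap_comp_f K c hc (φ ≫ ψ) j).trans ?_
    refine (congrArg (((c x).π.app j).f ≫ ·) ((K.obj j).map_comp φ ψ)).trans ?_
    exact (square_comp (limitMap_comp_f K c hc φ j) (limitMap_comp_f K c hc ψ j)).symm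

/-- The pointwise limit cone. -/
@[simps]
def limitCone : Cone K where
  pt := limitObj K c hc
  π :=
    { app j :=
        { app x := (c x).π.app j
          naturality φ := limitMap_comp K c hc φ j }
      naturality _ _ f := hom_ext fun x => (c x).π.naturality f }

/-- The pointwise limit is a limit. -/
def isLimitLimitCone : IsLimit (limitCone K c hc) where
  lift s :=
    { app x := (hc x).lift ((ev U x).mapCone s)
      naturality {x y} φ :=
        (isLimitOfPreserves (restrict (U.map φ)) (hc y)).hom_ext fun j => by
          have h := congrArg (restrict (U.map φ)).map ((hc y).fac ((ev U y).mapCone s) j)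
          rw [Functor.map_comp] at h
          refine (Category.assoc _ _ _).trans ?_
          refine (congrArg (_ ≫ ·) h).trans ?_
          refine ((s.π.app j).naturality φ).trans ?_
          refine Eq.trans ?_ (Category.assoc _ _ _).symm
          refine Eq.trans ?_ (congrArg (_ ≫ ·) (limitMap_comp K c hc φ j).symm)
          refine Eq.trans ?_ (Category.assoc _ _ _)
          exact congrArg (· ≫ _) ((hc x).fac ((ev U x).mapCone s) j).symm }
  fac s j := hom_ext fun x => (hc x).fac ((ev U x).mapCone s) j
  uniq s m h := hom_ext fun x => (hc x).uniq ((ev U x).mapCone s) (m.app x) fun j =>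
    congrArg (fun q => Hom.app q x) (h j)

theorem hasLimitsOfShape [∀ x, HasLimitsOfShape J (U.obj x).Algebra] :
    HasLimitsOfShape J (Mod U) :=
  ⟨fun K => ⟨⟨_, isLimitLimitCone K (fun x => limit.cone (K ⋙ ev U x))
    fun _ => limit.isLimit _⟩⟩⟩

theorem preservesLimitsOfShape_ev [∀ x, HasLimitsOfShape J (U.obj x).Algebra] (x : Q) :
    PreservesLimitsOfShape J (ev U x) :=
  ⟨fun {K} => preservesLimit_of_preserves_limit_cone
    (isLimitLimitCone K (fun x => limit.cone (K ⋙ ev U x)) fun _ => limit.isLimit _)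
    (limit.isLimit (K ⋙ ev U x))⟩

end Limits

end Mod

end MonadQuiver
end

/-! ### Closure of cartesian modules under limits and colimits, and exactness -/

noncomputable section

namespace MonadQuiver

variable {C : Type u} [Category.{v} C] {Q : Type v} [PartialOrder Q] (U : Q ⥤ Monad C)

section Comparison

variable [∀ x, HasCoequalizers (U.obj x).Algebra]

/-- The natural transformation `φ^* M_x ⟶ M_y`. -/
@[simps]
def comparison {x y : Q} (φ : x ⟶ y) : Mod.ev U x ⋙ extend (U.map φ) ⟶ Mod.ev U y where
  app M := ((extendAdj (U.map φ)).homEquiv (M.obj x) (M.obj y)).symm (M.map φ)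
  naturality M N f := by
    refine ((extendAdj (U.map φ)).homEquiv_naturality_left_symm _ _).symm.trans ?_
    refine Eq.trans ?_ ((extendAdj (U.map φ)).homEquiv_naturality_right_symm _ _)
    exact congrArg _ (f.naturality φ).symm

instance isCartesian_isClosedUnderIsomorphisms : (isCartesian U).IsClosedUnderIsomorphisms where
  of_iso e h x y φ := by
    have := h φ
    exact (NatTrans.isIso_app_iff_of_iso (comparison U φ) e).1 this

instance {x y : Q} (φ : x ⟶ y) : PreservesColimitsOfSize.{v, v} (extend (U.map φ)) :=
  (extendAdj (U.map φ)).leftAdjoint_preservesColimits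

variable (J : Type*) [Category* J]

/-- Both ends of the comparison preserve the colimit: evaluation because colimits are pointwise,
`φ^*` because it is a left adjoint. -/
theorem isClosedUnderColimitsOfShape_isCartesian [∀ x, HasColimitsOfShape J (U.obj x).Algebra]
    [∀ x, PreservesColimitsOfShape J (U.obj x).forget] :
    (isCartesian U).IsClosedUnderColimitsOfShape J where
  colimitsOfShape_le := by
    rintro M ⟨p⟩ x y φ
    have (z : Q) := Mod.preservesColimitsOfShape_ev (U := U) (J := J) z
    have := (extendAdj (U.map φ)).leftAdjoint_preservesColimits
    have (j : J) : IsIso ((comparison U φ).app (p.diag.obj j)) := p.prop_diag_obj j φ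
    exact isIso_app_pt_of_isColimit (comparison U φ)
      (isColimitOfPreserves (Mod.ev U x ⋙ extend (U.map φ)) p.isColimit)
      (isColimitOfPreserves (Mod.ev U y) p.isColimit)

theorem isClosedUnderLimitsOfShape_isCartesian [∀ x, HasLimitsOfShape J (U.obj x).Algebra]
    (hU : ∀ ⦃x y : Q⦄ (φ : x ⟶ y), PreservesLimitsOfShape J (extend (U.map φ))) :
    (isCartesian U).IsClosedUnderLimitsOfShape J where
  limitsOfShape_le := by
    rintro M ⟨p⟩ x y φ
    have (z : Q) := Mod.preservesLimitsOfShape_ev (U := U) (J := J) z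
    have := hU φ
    have (j : J) : IsIso ((comparison U φ).app (p.diag.obj j)) := p.prop_diag_obj j φ
    exact isIso_app_pt_of_isLimit (comparison U φ)
      (isLimitOfPreserves (Mod.ev U x ⋙ extend (U.map φ)) p.isLimit)
      (isLimitOfPreserves (Mod.ev U y) p.isLimit)

end Comparison

section Grothendieck

variable [Abelian C] [IsGrothendieckAbelian.{v} C] [∀ x, PreservesFiniteLimits (U.obj x).toFunctor]
    [∀ x, PreservesColimits (U.obj x).toFunctor]

instance : HasColimits (Mod U) := ⟨fun _ _ => Mod.hasColimitsOfShape⟩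

instance : HasFiniteLimits (Mod U) := ⟨fun _ _ _ => Mod.hasLimitsOfShape⟩

instance (x : Q) : PreservesColimits (Mod.ev U x) :=
  ⟨fun {_ _} => Mod.preservesColimitsOfShape_ev x⟩

instance (x : Q) : PreservesFiniteLimits (Mod.ev U x) :=
  ⟨fun _ _ _ => Mod.preservesLimitsOfShape_ev x⟩

instance : PreservesColimits (Mod.forget U) :=
  ⟨fun {_ _} => preservesColimitsOfShape_of_evaluation _ _ fun x =>
    inferInstanceAs (PreservesColimitsOfShape _ (Mod.ev U x ⋙ (U.obj x).forget))⟩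

instance : PreservesFiniteLimits (Mod.forget U) :=
  ⟨fun _ _ _ => preservesLimitsOfShape_of_evaluation _ _ fun x =>
    inferInstanceAs (PreservesLimitsOfShape _ (Mod.ev U x ⋙ (U.obj x).forget))⟩

instance : HasColimits (Cart U) :=
  ⟨fun J _ =>
    have := isClosedUnderColimitsOfShape_isCartesian U J
    inferInstance⟩

instance : PreservesColimits (isCartesian U).ι :=
  ⟨fun {J _} =>
    have := isClosedUnderColimitsOfShape_isCartesian U J
    inferInstance⟩

instance : ((isCartesian U).ι ⋙ Mod.forget U).ReflectsIsomorphisms :=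
  have : (isCartesian U).ι.ReflectsIsomorphisms := reflectsIsomorphisms_of_full_and_faithful _
  reflectsIsomorphisms_comp _ _

variable {U}

theorem hasFiniteLimits_cart (hU : Flat U) : HasFiniteLimits (Cart U) :=
  ⟨fun J _ _ =>
    have := isClosedUnderLimitsOfShape_isCartesian U J fun _ _ φ =>
      (hU φ).preservesFiniteLimits.preservesFiniteLimits J
    inferInstance⟩

theorem preservesFiniteLimits_cart_ι (hU : Flat U) : PreservesFiniteLimits (isCartesian U).ι :=
  ⟨fun J _ _ =>
    have := isClosedUnderLimitsOfShape_isCartesian U J fun _ _ φ =>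
      (hU φ).preservesFiniteLimits.preservesFiniteLimits J
    inferInstance⟩

/-- The category of cartesian modules over a flat monad quiver is abelian. -/
abbrev abelianCart (hU : Flat U) : Abelian (Cart U) :=
  have := hasFiniteLimits_cart hU
  have := preservesFiniteLimits_cart_ι hU
  have : HasFiniteColimits (Cart U) := hasFiniteColimits_of_hasColimits _
  have : PreservesFiniteColimits ((isCartesian U).ι ⋙ Mod.forget U) :=
    PreservesColimits.preservesFiniteColimits _
  abelianOfExactConservative ((isCartesian U).ι ⋙ Mod.forget U)

theorem isGrothendieckAbelian_cart (hU : Flat U) [HasSeparator (Cart U)] :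
    letI := abelianCart hU
    IsGrothendieckAbelian.{v} (Cart U) :=
  letI := abelianCart hU
  have := preservesFiniteLimits_cart_ι hU
  { hasFilteredColimitsOfSize := ⟨fun _ _ _ => inferInstance⟩
    ab5OfSize := by
      have : HasFilteredColimitsOfSize.{v, v} (Cart U) := ⟨fun _ _ _ => inferInstance⟩
      have : HasFilteredColimitsOfSize.{v, v} (Q ⥤ C) := ⟨fun _ _ _ => inferInstance⟩
      have : AB5OfSize.{v, v} (Q ⥤ C) := ⟨fun _ _ _ => inferInstance⟩
      exact ab5OfSize_of_exact_conservative ((isCartesian U).ι ⋙ Mod.forget U) }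

end Grothendieck

end MonadQuiver
end

/-! ### Generated subobjects and factorization through filtered unions -/

noncomputable section

namespace MonadQuiver

section Span

variable {D : Type*} [Category.{v} D] [Abelian D] [IsGrothendieckAbelian.{v} D]

/-- The subobject generated by a family of morphisms out of an object `G`. -/
def span {G M : D} {ι : Type v} (b : ι → (G ⟶ M)) : Subobject M :=
  imageSubobject (Sigma.desc b)

/-- The projection from a coproduct of copies of `G` to the subobject generated by a family. -/
def spanProj {G M : D} {ι : Type v} (b : ι → (G ⟶ M)) : (∐ fun _ : ι => G) ⟶ (span b : D) :=
  factorThruImageSubobject (Sigma.desc b)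

instance epi_spanProj {G M : D} {ι : Type v} (b : ι → (G ⟶ M)) : Epi (spanProj b) :=
  inferInstanceAs (Epi (factorThruImageSubobject (Sigma.desc b)))

theorem spanProj_arrow {G M : D} {ι : Type v} (b : ι → (G ⟶ M)) :
    spanProj b ≫ (span b).arrow = Sigma.desc b :=
  imageSubobject_arrow_comp _

theorem span_factors {G M : D} {ι : Type v} (b : ι → (G ⟶ M)) (i : ι) :
    (span b).Factors (b i) := by
  have := imageSubobject_factors_comp_self (f := Sigma.desc b) (Sigma.ι (fun _ : ι => G) i)
  rwa [Sigma.ι_desc] at this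

theorem span_le {G M : D} {ι : Type v} {b : ι → (G ⟶ M)} {T : Subobject M}
    (h : ∀ i, T.Factors (b i)) : span b ≤ T :=
  imageSubobject_le _ (Sigma.desc fun i => T.factorThru (b i) (h i)) (by
    ext i
    simp)

/-- A morphism factors through a subobject as soon as all its composites with morphisms out of a
separator do. -/
theorem factors_of_isSeparator {G : D} (hG : IsSeparator G) {X M : D} (f : X ⟶ M)
    (T : Subobject M) (h : ∀ k : G ⟶ X, T.Factors (k ≫ f)) : T.Factors f := by
  -- By hypothesis every `G ⟶ X` factors through the pullback of `T`; a separator here is also a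
  -- detector, so the pullback is all of `X`.
  have : IsIso ((Subobject.pullback f).obj T).arrow := by
    refine (ObjectProperty.IsDetecting.isIso_iff_of_mono hG.isDetector _).2 ?_
    intro G' hG' k
    obtain rfl : G = G' := by simpa using hG'
    exact ⟨Subobject.factorThru _ k ((Limits.pullback_factors_iff f T k).2 (h k)),
      Subobject.factorThru_arrow _ _ _⟩
  obtain ⟨r, -, hr⟩ := this.out
  have h' := (Limits.pullback_factors_iff f T (𝟙 X)).1 ((Subobject.factors_iff _ _).2 ⟨r, hr⟩)
  rwa [Category.id_comp] at h'

end Span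

section Compactness

attribute [local instance] IsFiltered.isConnected

open IsGrothendieckAbelian.IsPresentable.surjectivity in
/-- A morphism from `A` to a filtered union factors through every subobject that contains a
suitable family, indexed by the subobjects of `A`, of the members of the union. -/
theorem exists_factors_of_isColimit {D : Type*} [Category.{v} D] [Abelian D]
    [IsGrothendieckAbelian.{v} D] {J : Type v} [SmallCategory J] [IsFiltered J] {Y : J ⥤ D}
    [∀ (i j : J) (f : i ⟶ j), Mono (Y.map f)] {c : Cocone Y} (hc : IsColimit c) {A : D}
    (a : A ⟶ c.pt) :
    ∃ t : Subobject A → J, ∀ T : Subobject c.pt, (∀ k, T.Factors (c.ι.app (t k))) →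
      T.Factors a := by
  have := hc.mono_ι_app_of_isFiltered
  have := NatTrans.mono_of_mono_app c.ι
  let p (j : J) : (pullback c.ι ((Functor.const J).map a)).obj j ⟶ A :=
    (pullback.snd c.ι ((Functor.const J).map a)).app j
  have hp (j : J) : Mono (p j) :=
    inferInstanceAs (Mono ((pullback.snd c.ι ((Functor.const J).map a)).app j))
  have hpa (j : J) : p j ≫ a =
      (pullback.fst c.ι ((Functor.const J).map a)).app j ≫ c.ι.app j :=
    (NatTrans.congr_app (pullback.condition (f := c.ι) (g := (Functor.const J).map a)) j).symm
  let g : colimit (pullback c.ι ((Functor.const J).map a)) ⟶ A := f a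
  have : IsIso g := isIso_f hc a
  let s (j : J) : Subobject A := Subobject.mk (p j)
  have hs : ⨆ j, s j = ⊤ :=
    (IsGrothendieckAbelian.subobjectMk_of_isColimit_eq_iSup (F a) (colimit.isColimit _) g
      (hf a)).symm.trans (Subobject.mk_eq_top_of_isIso g)
  have := IsFiltered.nonempty (C := J)
  -- Many stages may pull back to the same subobject of `A`; keeping one stage for each loses
  -- nothing, since the pullback of `T` only has to contain every `s j`, and their supremum is `⊤`.
  refine ⟨Function.invFun s, fun T hT => ?_⟩
  have hT' : (Subobject.pullback a).obj T = ⊤ := by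
    rw [← top_le_iff, ← hs, iSup_le_iff]
    intro j
    rw [← Function.invFun_eq (f := s) ⟨j, rfl⟩]
    set i := Function.invFun s (s j)
    refine Subobject.le_of_comm (Subobject.factorThru _ (s i).arrow ?_)
      (Subobject.factorThru_arrow _ _ _)
    rw [Limits.pullback_factors_iff]
    have h' : (s i).arrow ≫ a = ((Subobject.underlyingIso (p i)).hom ≫
        (pullback.fst c.ι ((Functor.const J).map a)).app i) ≫ c.ι.app i := by
      rw [Category.assoc, ← hpa, Subobject.underlyingIso_hom_comp_eq_mk_assoc]
    rw [h']
    exact Subobject.factors_of_factors_right _ (hT _)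
  have := (Limits.pullback_factors_iff a T (𝟙 A)).1 (by rw [hT']; exact Subobject.top_factors _)
  rwa [Category.id_comp] at this

/-- If `L` is a cocontinuous functor that preserves monomorphisms and `G` is a separator of its
source, then every morphism `A ⟶ L M` factors through `L S` for each subobject `S` of `M` that contains
suitable finite sets, indexed by the subobjects of `A`, of morphisms `G ⟶ M`. -/
theorem exists_factors_map_arrow {D D' : Type*} [Category.{v} D] [Abelian D]
    [IsGrothendieckAbelian.{v} D] [Category.{v} D'] [Abelian D'] [IsGrothendieckAbelian.{v} D']
    (L : D ⥤ D') [L.PreservesMonomorphisms] [PreservesColimitsOfSize.{v, v} L] {G : D}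
    (hG : IsSeparator G) {M : D} {A : D'} (a : A ⟶ L.obj M) :
    ∃ t : Subobject A → Finset (G ⟶ M), ∀ S : Subobject M, (∀ k, ∀ b ∈ t k, S.Factors b) →
      ∃ h : A ⟶ L.obj (S : D), h ≫ L.map S.arrow = a := by
  let s (B : Finset (G ⟶ M)) : Subobject M := span fun b : B => b.1
  have hs : Monotone s := fun B B' h => span_le fun b =>
    span_factors (fun b : B' => b.1) ⟨b.1, h b.2⟩
  let F : Finset (G ⟶ M) ⥤ MonoOver M := hs.functor ⋙ Subobject.representative
  let c : Cocone (F ⋙ MonoOver.forget M) :=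
    { pt := Over.mk (𝟙 M)
      ι :=
        { app B := Over.homMk (s B).arrow (Category.comp_id _)
          naturality B B' h := by
            ext
            exact (Over.w (F.map h).hom).trans (Category.comp_id _).symm } }
  have : Mono c.pt.hom := inferInstanceAs (Mono (𝟙 M))
  -- Singletons already exhaust `M`, because `G` is a separator; finite sets serve to make the union
  -- filtered.
  have htop : Subobject.mk c.pt.hom = ⨆ B, Subobject.mk (F.obj B).obj.hom := by
    have h₁ : ⨆ B, s B = ⊤ := by
      refine top_le_iff.1 (Subobject.le_of_factors (factors_of_isSeparator hG _ _ fun k => ?_))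
      exact Subobject.factors_of_le _ (le_iSup s {k ≫ (⊤ : Subobject M).arrow})
        (span_factors (fun b : ({k ≫ (⊤ : Subobject M).arrow} : Finset (G ⟶ M)) => b.1)
          ⟨_, Finset.mem_singleton_self _⟩)
    have h₂ (B : Finset (G ⟶ M)) : Subobject.mk (F.obj B).obj.hom = s B := Subobject.mk_arrow (s B)
    rw [iSup_congr h₂, h₁]
    exact Subobject.mk_eq_top_of_isIso (𝟙 M)
  have hc := isColimitOfPreserves L
    (IsGrothendieckAbelian.isColimitMapCoconeOfSubobjectMkEqISup F c htop)
  have (B B' : Finset (G ⟶ M)) (h : B ⟶ B') :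
      Mono ((((F ⋙ MonoOver.forget M) ⋙ Over.forget M) ⋙ L).map h) := by
    have : Mono (F.map h).hom.left := by
      have : Mono ((F.map h).hom.left ≫ (F.obj B').obj.hom) := by
        rw [Over.w]
        infer_instance
      exact mono_of_mono _ (F.obj B').obj.hom
    exact inferInstanceAs (Mono (L.map (F.map h).hom.left))
  obtain ⟨t, ht⟩ := exists_factors_of_isColimit hc a
  refine ⟨t, fun S hS => ?_⟩
  let T : Subobject (L.obj M) := Subobject.mk (L.map S.arrow)
  have h : T.Factors a := ht T fun k => by
    have hk : s (t k) ≤ S := span_le fun b => hS k b.1 b.2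
    have h' : T.Factors (L.map (s (t k)).arrow) := by
      refine (Subobject.mk_factors_iff _ _).2 ⟨L.map (Subobject.ofLE _ _ hk), ?_⟩
      exact (L.map_comp _ _).symm.trans (congrArg L.map (Subobject.ofLE_arrow hk))
    exact h'
  obtain ⟨h, hh⟩ := (Subobject.mk_factors_iff _ _).1 h
  exact ⟨h, hh⟩

end Compactness

end MonadQuiver
end

/-! ### Transport of module structures, and cartesian submodules -/

noncomputable section

namespace MonadQuiver

variable {C : Type u} [Category.{v} C] {Q : Type v} [PartialOrder Q] {U : Q ⥤ Monad C}

/-- The morphism `φ^* M_x ⟶ M_y` adjoint to the structure morphism of a module. -/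
def Mod.adjointMap [∀ x, HasCoequalizers (U.obj x).Algebra] (M : Mod U) {x y : Q} (φ : x ⟶ y) :
    (extend (U.map φ)).obj (M.obj x) ⟶ M.obj y :=
  ((extendAdj (U.map φ)).homEquiv (M.obj x) (M.obj y)).symm (M.map φ)

section Transport

theorem comp_comp_eq_of_inverse {A : Type*} [Category* A] {X X' Y Y' Z Z' : A} {a : X' ⟶ X}
    {n : X ⟶ Z} {f : X ⟶ Y} {g : Y ⟶ Z} {b : Y ⟶ Y'} {c : Y' ⟶ Y} {d : Z ⟶ Z'} (hn : n = f ≫ g)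
    (h : b ≫ c = 𝟙 Y) : a ≫ n ≫ d = (a ≫ f ≫ b) ≫ c ≫ g ≫ d := by
  rw [hn, Category.assoc, Category.assoc, Category.assoc, reassoc_of% h]

/-- The module structures on a family of algebras. -/
def Structures (X : ∀ x, (U.obj x).Algebra) : Type v :=
  {m : ∀ x y (φ : x ⟶ y), X x ⟶ (restrict (U.map φ)).obj (X y) //
    (∀ x, (m x x (𝟙 x)).f = 𝟙 (X x).A) ∧
    ∀ x y z (φ : x ⟶ y) (ψ : y ⟶ z), (m x z (φ ≫ ψ)).f = (m x y φ).f ≫ (m y z ψ).f}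

/-- The module given by a module structure on a family of algebras. -/
def Structures.toMod {X : ∀ x, (U.obj x).Algebra} (m : Structures X) : Mod U where
  obj := X
  map φ := m.1 _ _ φ
  map_id := m.2.1
  map_comp φ ψ := m.2.2 _ _ _ φ ψ

/-- Module structures can be transported along isomorphisms of algebras. -/
theorem exists_iso_toMod (N : Mod U) {X : ∀ x, (U.obj x).Algebra} (e : ∀ x, N.obj x ≅ X x) :
    ∃ m : Structures X, Nonempty (N ≅ m.toMod) := by
  have h (x : Q) : (e x).inv.f ≫ (e x).hom.f = 𝟙 (X x).A :=
    congrArg Monad.Algebra.Hom.f (e x).inv_hom_id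
  have h' (x : Q) : (e x).hom.f ≫ (e x).inv.f = 𝟙 (N.obj x).A :=
    congrArg Monad.Algebra.Hom.f (e x).hom_inv_id
  refine ⟨⟨fun x y φ => (e x).inv ≫ N.map φ ≫ (restrict (U.map φ)).map (e y).hom, fun x => ?_,
    fun x y z φ ψ => ?_⟩, ⟨Mod.isoMk e fun x y φ => ?_⟩⟩
  · refine Eq.trans ?_ (h x)
    refine congrArg ((e x).inv.f ≫ ·) ?_
    exact (congrArg (· ≫ (e x).hom.f) (N.map_id x)).trans (Category.id_comp _)
  · exact comp_comp_eq_of_inverse (N.map_comp φ ψ) (h' y)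
  · exact (Iso.hom_inv_id_assoc _ _).symm

end Transport

section Submodule

/-- A subobject of `M` whose generators lift to a monomorphism `L ⟶ M` that factors through it is
isomorphic to `L`. -/
theorem isIso_of_comp_span_arrow {D : Type*} [Category.{v} D] [Abelian D]
    [IsGrothendieckAbelian.{v} D] {G L M : D} {ι : Type v} {b : ι → (G ⟶ M)} (r : L ⟶ M) [Mono r]
    (q : L ⟶ (span b : D)) (hq : q ≫ (span b).arrow = r) (h : ∀ i, ∃ k : G ⟶ L, k ≫ r = b i) :
    IsIso q := by
  have : Mono (q ≫ (span b).arrow) := by rwa [hq]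
  have : Mono q := mono_of_mono _ (span b).arrow
  choose k hk using h
  -- The canonical cover of the span factors through `q`, which makes `q` epi.
  have e : Sigma.desc k ≫ q = spanProj b := by
    rw [← cancel_mono (span b).arrow, spanProj_arrow]
    ext i
    rw [Category.assoc, hq, Sigma.ι_desc_assoc, Sigma.ι_desc, hk]
  have : Epi (Sigma.desc k ≫ q) := by
    rw [e]
    infer_instance
  have : Epi q := epi_of_epi (Sigma.desc k) q
  exact isIso_of_mono_of_epi q

variable [Abelian C] [IsGrothendieckAbelian.{v} C] [∀ x, PreservesFiniteLimits (U.obj x).toFunctor]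
    [∀ x, PreservesColimits (U.obj x).toFunctor]

instance mono_f {T : Monad C} {X Y : T.Algebra} (f : X ⟶ Y) [Mono f] : Mono f.f :=
  inferInstanceAs (Mono (T.forget.map f))

variable (M : Mod U) (S : ∀ x, Subobject (M.obj x))
  (m : ∀ ⦃x y : Q⦄ (φ : x ⟶ y), (S x : (U.obj x).Algebra) ⟶
    (restrict (U.map φ)).obj (S y : (U.obj y).Algebra))
  (hm : ∀ ⦃x y : Q⦄ (φ : x ⟶ y),
    m φ ≫ (restrict (U.map φ)).map (S y).arrow = (S x).arrow ≫ M.map φ)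

/-- The submodule given by a family of subobjects that is stable under the structure morphisms. -/
@[simps]
def submodule : Mod U where
  obj x := (S x : (U.obj x).Algebra)
  map φ := m φ
  map_id x := by
    refine (cancel_mono (S x).arrow.f).1 ?_
    refine (congrArg Monad.Algebra.Hom.f (hm (𝟙 x))).trans ?_
    refine (congrArg ((S x).arrow.f ≫ ·) (M.map_id x)).trans ?_
    exact (Category.comp_id _).trans (Category.id_comp _).symm
  map_comp {x y z} φ ψ := by
    refine (cancel_mono (S z).arrow.f).1 ?_
    refine (congrArg Monad.Algebra.Hom.f (hm (φ ≫ ψ))).trans ?_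
    refine (congrArg ((S x).arrow.f ≫ ·) (M.map_comp φ ψ)).trans ?_
    exact (square_comp (congrArg Monad.Algebra.Hom.f (hm φ))
      (congrArg Monad.Algebra.Hom.f (hm ψ))).symm

/-- The inclusion of a submodule. -/
@[simps]
def submoduleι : submodule M S m hm ⟶ M where
  app x := (S x).arrow
  naturality φ := hm φ

/-- A submodule of a cartesian module is cartesian if it is generated by families of morphisms that
lift to the extensions of scalars of its components. -/
theorem isCartesian_submodule (hU : Flat U) (hM : isCartesian U M)
    {G : ∀ x, (U.obj x).Algebra} {ι : Type v} (b : ∀ x, ι → (G x ⟶ M.obj x))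
    (hb : ∀ x, S x = span (b x))
    (hlift : ∀ ⦃x y : Q⦄ (φ : x ⟶ y) (i : ι), ∃ h : G y ⟶ (extend (U.map φ)).obj (S x),
      h ≫ (extend (U.map φ)).map (S x).arrow ≫ M.adjointMap φ = b y i) :
    isCartesian U (submodule M S m hm) := by
  obtain rfl : S = fun x => span (b x) := funext hb
  intro x y φ
  have : IsIso (M.adjointMap φ) := hM φ
  have := (hU φ).preservesFiniteLimits
  -- The composite is mono since `φ^*` preserves monomorphisms and `M` is cartesian; naturality of
  -- the comparison says that it factors through the span over `y` by the adjoint map of the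
  -- submodule.
  exact isIso_of_comp_span_arrow ((extend (U.map φ)).map (span (b x)).arrow ≫ M.adjointMap φ)
    ((submodule M _ m hm).adjointMap φ)
    ((comparison U φ).naturality (submoduleι M _ m hm)).symm (hlift φ)

end Submodule

end MonadQuiver
end

/-! ### Bounded cartesian submodules and the separator -/

noncomputable section

namespace MonadQuiver

variable {C : Type u} [Category.{v} C] {Q : Type v} [PartialOrder Q] {U : Q ⥤ Monad C}
  [Abelian C] [IsGrothendieckAbelian.{v} C] [∀ x, PreservesColimits (U.obj x).toFunctor]

/-- A subobject contains the image under the structure morphism of every element whose extension of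
scalars factors through it. -/
theorem factors_map_of_factors_adjointMap (M : Mod U) {x y : Q} (φ : x ⟶ y)
    (S : Subobject (M.obj y)) {X : (U.obj x).Algebra} (a : X ⟶ M.obj x)
    (h : S.Factors ((extend (U.map φ)).map a ≫ M.adjointMap φ)) :
    (Subobject.mk ((restrict (U.map φ)).map S.arrow)).Factors (a ≫ M.map φ) := by
  rw [Subobject.mk_factors_iff]
  refine ⟨(extendAdj (U.map φ)).homEquiv _ _ (S.factorThru _ h), ?_⟩
  refine ((extendAdj (U.map φ)).homEquiv_naturality_right _ _).symm.trans ?_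
  rw [Subobject.factorThru_arrow, Adjunction.homEquiv_naturality_left, Mod.adjointMap,
    Equiv.apply_symm_apply]

variable [∀ x, PreservesFiniteLimits (U.obj x).toFunctor]

/-- A quotient is the cokernel of its kernel subobject. -/
def isoCokernelKernelSubobject {D : Type*} [Category* D] [Abelian D] {X Y : D} (p : X ⟶ Y)
    [Epi p] : Y ≅ cokernel (kernelSubobject p).arrow :=
  (Abelian.epiIsCokernelOfKernel _ (kernelIsKernel p)).coconePointUniqueUpToIso
    (cokernelIsCokernel (kernel.ι p)) ≪≫
    (cokernelEpiComp (kernelSubobjectIso p).hom (kernel.ι p)).symm ≪≫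
    cokernelIsoOfEq (kernelSubobject_arrow p)

section Closure

variable (G : ∀ x, (U.obj x).Algebra)

/-- The indices of the elements which a cartesian submodule has to contain together with a given
element over `x`. -/
def DependentIndex (x : Q) : Type v :=
  (Σ (y : Q) (φ : x ⟶ y), G y ⟶ (extend (U.map φ)).obj (G x)) ⊕
    (Σ (z : Q) (_ : z ⟶ x), Shrink.{v} (Subobject (G x)) × ℕ)

/-- The elements of a module. -/
abbrev Elements (M : Mod U) : Type v := Σ x, G x ⟶ M.obj x

variable {G} {M : Mod U}
  (t : ∀ (a : Elements G M) ⦃z : Q⦄ (_ : z ⟶ a.1), Subobject (G a.1) → Finset (G z ⟶ M.obj z))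

/-- The elements which a cartesian submodule has to contain together with a given element. -/
def dependent (a : Elements G M) : DependentIndex G a.1 → Elements G M
  | .inl ⟨y, φ, k⟩ => ⟨y, k ≫ (extend (U.map φ)).map a.2 ≫ M.adjointMap φ⟩
  -- Padding by `0` lets `ℕ` enumerate every finite set, so that the index type is independent of
  -- `M`.
  | .inr ⟨z, φ, k, n⟩ => ⟨z, (t a φ ((equivShrink _).symm k)).toList.getD n 0⟩

/-- The elements obtained from a given one by passing repeatedly to dependent elements. -/
def reach (a : Elements G M) (l : List (Σ x, DependentIndex G x)) : Elements G M :=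
  -- A letter carries its own base point; if that is not the base point of the current element, the
  -- element stays unchanged. So all words are admissible for every module.
  l.foldl (fun b => Function.extend (Sigma.mk b.1) (dependent t b) fun _ => b) a

theorem exists_reach_eq_dependent (a : Elements G M) (l : List (Σ x, DependentIndex G x))
    (w : DependentIndex G (reach t a l).1) : ∃ l', reach t a l' = dependent t (reach t a l) w := by
  refine ⟨l ++ [⟨_, w⟩], ?_⟩
  rw [reach, List.foldl_append, List.foldl_cons, List.foldl_nil]
  exact sigma_mk_injective.extend_apply (dependent t (reach t a l)) _ w

open Classical in
/-- The reachable elements over `x`. -/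
def reachOver (a : Elements G M) (x : Q) (l : List (Σ x, DependentIndex G x)) : G x ⟶ M.obj x :=
  -- Words ending over another point contribute `0`, so that the same index type serves every `x`.
  if h : (reach t a l).1 = x then h ▸ (reach t a l).2 else 0

theorem reachOver_induction (a : Elements G M) (P : ∀ x, (G x ⟶ M.obj x) → Prop)
    (h0 : ∀ x, P x 0) (h : ∀ l, P _ (reach t a l).2) (x : Q) (l : List (Σ x, DependentIndex G x)) :
    P x (reachOver t a x l) := by
  unfold reachOver
  split_ifs with hx
  · subst hx
    exact h l
  · exact h0 x

theorem span_reachOver_factors {a b : Elements G M} (hb : ∃ l, reach t a l = b) :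
    (span (reachOver t a b.1)).Factors b.2 := by
  obtain ⟨l, rfl⟩ := hb
  have := span_factors (reachOver t a (reach t a l).1) l
  rwa [reachOver, dif_pos rfl] at this

end Closure

/-- Every element of a cartesian module is contained in a cartesian submodule all of whose
components are quotients of a coproduct of copies of the separators which does not depend on the
module. -/
theorem exists_isCartesian_submodule (hU : Flat U) {G : ∀ x, (U.obj x).Algebra}
    (hG : ∀ x, IsSeparator (G x)) (M : Mod U) (hM : isCartesian U M) {x : Q} (a : G x ⟶ M.obj x) :
    ∃ N : Mod U, isCartesian U N ∧
      (∀ y, ∃ p : (∐ fun _ : List (Σ x, DependentIndex G x) => G y) ⟶ N.obj y, Epi p) ∧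
      ∃ (i : N ⟶ M) (a' : G x ⟶ N.obj x), a' ≫ i.app x = a := by
  -- Down-closure data: invert the comparison to move the element into `φ^* M_z`, then apply the
  -- factorization through filtered unions.
  have ht (a : Elements G M) ⦃z : Q⦄ (φ : z ⟶ a.1) :
      ∃ t : Subobject (G a.1) → Finset (G z ⟶ M.obj z), ∀ S : Subobject (M.obj z),
        (∀ k, ∀ b ∈ t k, S.Factors b) → ∃ h : G a.1 ⟶ (extend (U.map φ)).obj S,
          h ≫ (extend (U.map φ)).map S.arrow ≫ M.adjointMap φ = a.2 := by
    have := (hU φ).preservesFiniteLimits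
    have : IsIso (M.adjointMap φ) := hM φ
    obtain ⟨t, ht⟩ := exists_factors_map_arrow (extend (U.map φ)) (hG z) (a.2 ≫ inv (M.adjointMap φ))
    refine ⟨t, fun S hS => ?_⟩
    obtain ⟨h, hh⟩ := ht S hS
    exact ⟨h, by rw [← Category.assoc, hh, Category.assoc, IsIso.inv_hom_id, Category.comp_id]⟩
  choose t ht using ht
  let b := reachOver t ⟨x, a⟩
  -- Stability under structure morphisms. It is enough to test generators; after transposing to
  -- `φ^*`, testing on elements over `z` produces exactly the `.inl` dependents.
  have hup ⦃y z : Q⦄ (φ : y ⟶ z) :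
      (Subobject.mk ((restrict (U.map φ)).map (span (b z)).arrow)).Factors
        ((span (b y)).arrow ≫ M.map φ) := by
    rw [← pullback_factors_iff]
    refine Subobject.factors_of_le _ (span_le fun l => ?_) (Subobject.factors_self _)
    rw [pullback_factors_iff]
    refine factors_map_of_factors_adjointMap M φ _ _ ?_
    revert z
    refine reachOver_induction t ⟨x, a⟩ (fun y c => ∀ ⦃z : Q⦄ (φ : y ⟶ z),
      (span (b z)).Factors ((extend (U.map φ)).map c ≫ M.adjointMap φ)) (fun y z φ => ?_)
      (fun l z φ => ?_) y l
    · have := (hU φ).preservesFiniteLimits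
      rw [Functor.map_zero, zero_comp]
      exact Subobject.factors_zero
    · refine factors_of_isSeparator (hG z) _ _ fun k => ?_
      exact span_reachOver_factors t (exists_reach_eq_dependent t ⟨x, a⟩ l (.inl ⟨z, φ, k⟩))
  -- Generators lift because the span over `y` contains all finite sets required by `ht`, through
  -- the `.inr` dependents.
  have hdown ⦃y z : Q⦄ (φ : y ⟶ z) (l) : ∃ h : G z ⟶ (extend (U.map φ)).obj (span (b y)),
      h ≫ (extend (U.map φ)).map (span (b y)).arrow ≫ M.adjointMap φ = b z l := by
    revert y
    refine reachOver_induction t ⟨x, a⟩ (fun z c => ∀ ⦃y : Q⦄ (φ : y ⟶ z),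
      ∃ h : G z ⟶ (extend (U.map φ)).obj (span (b y)),
        h ≫ (extend (U.map φ)).map (span (b y)).arrow ≫ M.adjointMap φ = c)
      (fun z y φ => ⟨0, zero_comp⟩) (fun l y φ => ?_) z l
    refine ht _ φ _ fun k c hc => ?_
    obtain ⟨n, hn, hc⟩ := List.mem_iff_getElem.1 (Finset.mem_toList.2 hc)
    have := span_reachOver_factors t
      (exists_reach_eq_dependent t ⟨x, a⟩ l (.inr ⟨y, φ, equivShrink _ k, n⟩))
    dsimp only [dependent] at this
    rwa [Equiv.symm_apply_apply, List.getD_eq_getElem _ _ hn, hc] at this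
  let m ⦃y z : Q⦄ (φ : y ⟶ z) := Subobject.factorThru _ _ (hup φ) ≫ (Subobject.underlyingIso _).hom
  have hm ⦃y z : Q⦄ (φ : y ⟶ z) : m φ ≫ (restrict (U.map φ)).map (span (b z)).arrow =
      (span (b y)).arrow ≫ M.map φ := by
    rw [Category.assoc, Subobject.underlyingIso_hom_comp_eq_mk, Subobject.factorThru_arrow]
  have hx : (span (b x)).Factors a := span_reachOver_factors t ⟨[], rfl⟩
  exact ⟨submodule M (fun y => span (b y)) m hm,
    isCartesian_submodule M _ m hm hU hM b (fun _ => rfl) hdown,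
    fun y => ⟨spanProj (b y), epi_spanProj (b y)⟩,
    submoduleι M _ m hm, Subobject.factorThru _ _ hx, Subobject.factorThru_arrow _ _ hx⟩

/-- The category of cartesian modules over a flat monad quiver has a separator. -/
theorem hasSeparator_cart (hU : Flat U) : HasSeparator (Cart U) := by
  let G (x : Q) : (U.obj x).Algebra := (U.obj x).free.obj (separator C)
  have hG (x : Q) : IsSeparator (G x) := isSeparator_free _ (isSeparator_separator C)
  let P (x : Q) : (U.obj x).Algebra := ∐ fun _ : List (Σ x, DependentIndex G x) => G x
  let R (s : ∀ x, Shrink.{v} (Subobject (P x))) (x : Q) : (U.obj x).Algebra :=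
    cokernel ((equivShrink _).symm (s x)).arrow
  -- A quotient of `P x` for each `x`, together with a cartesian structure on the family;
  -- well-poweredness makes this a type in `Type v`.
  let I : Type v := Σ s, {m : Structures (R s) // isCartesian U m.toMod}
  let F (i : I) : Cart U := ⟨i.2.1.toMod, i.2.2⟩
  have hF : ObjectProperty.IsSeparating (.ofObj F) := by
    intro M M' f g h
    refine ObjectProperty.hom_ext _ (Mod.hom_ext fun x => ?_)
    refine (hG x).def _ _ fun a => ?_
    obtain ⟨N, hN, hp, i, a, rfl⟩ := exists_isCartesian_submodule hU hG M.obj M.property a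
    choose p hp using hp
    let s (y : Q) : Shrink.{v} (Subobject (P y)) := equivShrink _ (kernelSubobject (p y))
    have hs (y : Q) : (equivShrink _).symm (s y) = kernelSubobject (p y) :=
      Equiv.symm_apply_apply _ _
    have e (y : Q) : Nonempty (N.obj y ≅ R s y) :=
      ⟨isoCokernelKernelSubobject (p y) ≪≫
        eqToIso (congrArg (fun S : Subobject (P y) => cokernel S.arrow) (hs y).symm)⟩
    -- The components of `N` are quotients of the `P y`, hence `N` is isomorphic to a member of the
    -- family `F`.
    obtain ⟨m, ⟨e'⟩⟩ := exists_iso_toMod N fun y => (e y).some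
    have h' := h (F ⟨s, m, (isCartesian U).prop_of_iso e' hN⟩) ⟨_⟩
      (ObjectProperty.homMk (e'.inv ≫ i))
    have h'' : i ≫ f.hom = i ≫ g.hom := by
      rw [← cancel_epi e'.inv, ← Category.assoc, ← Category.assoc]
      exact congrArg (fun k => k.hom) h'
    rw [Category.assoc, Category.assoc]
    exact congrArg (a ≫ ·) (congrArg (fun k => Mod.Hom.app k x) h'')
  exact ⟨⟨_, hF.isSeparator_coproduct⟩⟩

end MonadQuiver
end

theorem mainTheorem1 {C : Type u} [Category.{v} C] [Abelian C] [IsGrothendieckAbelian.{v} C]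
    (G : C) (hG : IsSeparator G) (hGproj : Projective G)
    {Q : Type v} [PartialOrder Q] (U : Q ⥤ Monad C)
    [∀ x, PreservesFiniteLimits (U.obj x).toFunctor]
    [∀ x, PreservesColimits (U.obj x).toFunctor]
    (hU : MonadQuiver.Flat U) :
    ∃ _ : Abelian (MonadQuiver.Cart U), IsGrothendieckAbelian.{v} (MonadQuiver.Cart U) :=
  have := MonadQuiver.hasSeparator_cart hU
  ⟨MonadQuiver.abelianCart hU, MonadQuiver.isGrothendieckAbelian_cart hU⟩
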